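/- A gyrogroup is a set $G$ with a binary operation $\oplus$, an identity element $0$, a two-sided inverse $\ominus x$ of each $x\in G$, and automorphisms $\mathrm{gyr}[x,y]$ of $(G,\oplus)$ with $x\oplus(y\oplus z)=(x\oplus y)\oplus\mathrm{gyr}[x,y](z)$ and $\mathrm{gyr}[x\oplus y,y]=\mathrm{gyr}[x,y]$ for all $x,y,z\in G$. A subgyrogroup is a nonempty subset $H\subseteq G$ that is a gyrogroup under the inherited operation and on which $\mathrm{gyr}[a,b]$ restricts to an automorphism of $H$ for all $a,b\in H$. Let $G$ be a Hausdorff topological gyrogroup, that is, a gyrogroup $(G,\oplus)$ with a Hausdorff topology for which $\oplus\colon G\times G\to G$ is jointly continuous and $x\mapsto\ominus x$ is continuous. Let $H$ be a closed $L$-subgyrogroup of $G$, that is, a closed subgyrogroup such that $\mathrm{gyr}[a,h](H)=H$ for all $a\in G$ and $h\in H$. Equip $H$ with the subspace topology and $G/H=\{a\oplus H: a\in G\}$ with the quotient topology with respect to $\pi\colon G\to G/H$, $a\mapsto a\oplus H$ (so $O\subseteq G/H$ is open if and only if $\pi^{-1}(O)$ is open in $G$). Call a topological space sequential if each of its sequentially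 closed subsets is closed. If every sequentially compact subset of $H$ and every sequentially compact subset of $G/H$ is sequential in its subspace topology, then every sequentially compact subset of $G$ is sequential in its subspace topology. In other words, "every sequentially compact subset is sequential" is a three-space property in topological gyrogroups. -/

import Mathlib

open Set Topology

universe u

/-- A gyrogroup, written additively: `x + y` is `x ⊕ y`, `-x` is `⊖ x`. The gyration `gyr x y` is an
automorphism of `(G, +)`. Uniqueness of the identity, of inverses and of the gyrations
follows from these axioms. -/
class Gyrogroup (G : Type u) extends Add G, Zero G, Neg G where
  zero_add (a : G) : 0 + a = a
  add_zero (a : G) : a + 0 = a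
  neg_add_self (a : G) : -a + a = 0
  add_neg_self (a : G) : a + -a = 0
  gyr : G → G → (G ≃+ G)
  gyr_assoc (x y z : G) : x + (y + z) = (x + y) + gyr x y z
  gyr_loop (x y : G) : gyr (x + y) y = gyr x y

namespace Gyrogroup

/-- A subgyrogroup: a nonempty subset on which the operation and the inversion of `G` restrict, and
on which every gyration `gyr a b` with `a, b ∈ H` restricts to a bijection (hence to an
automorphism) of `H`. Together with the axioms of `G` this says that `H` is a gyrogroup under the
inherited operation. -/
structure IsSubgyrogroup {G : Type u} [Gyrogroup G] (H : Set G) : Prop where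
  nonempty : H.Nonempty
  add_mem : ∀ a ∈ H, ∀ b ∈ H, a + b ∈ H
  neg_mem : ∀ a ∈ H, -a ∈ H
  gyr_image : ∀ a ∈ H, ∀ b ∈ H, gyr a b '' H = H

/-- An L-subgyrogroup: a subgyrogroup with `gyr[a, h](H) = H` for all `a ∈ G`, `h ∈ H`. -/
structure IsLSubgyrogroup {G : Type u} [Gyrogroup G] (H : Set G) : Prop
    extends IsSubgyrogroup H where
  gyr_image_left : ∀ a : G, ∀ h ∈ H, gyr a h '' H = H

/-- The left coset `a ⊕ H`. -/
def leftCoset {G : Type u} [Gyrogroup G] (H : Set G) (a : G) : Set G :=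
  (fun h => a + h) '' H

/-- The coset space `G/H = {a ⊕ H : a ∈ G}`. -/
def CosetSpace {G : Type u} [Gyrogroup G] (H : Set G) : Type u :=
  {C : Set G // ∃ a : G, leftCoset H a = C}

/-- The canonical map `π : G → G/H`, `a ↦ a ⊕ H`. -/
def CosetSpace.mk {G : Type u} [Gyrogroup G] (H : Set G) (a : G) : CosetSpace H :=
  ⟨leftCoset H a, a, rfl⟩

/-- The quotient topology on `G/H`: `O` is open if and only if `π⁻¹(O)` is open in `G`. -/
instance CosetSpace.instTopologicalSpace {G : Type u} [Gyrogroup G] [TopologicalSpace G]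
    (H : Set G) : TopologicalSpace (CosetSpace H) :=
  TopologicalSpace.coinduced (CosetSpace.mk H) inferInstance

end Gyrogroup

/-- A topological gyrogroup: `⊕` is jointly continuous and `⊖` is continuous. -/
class IsTopologicalGyrogroup (G : Type u) [TopologicalSpace G] [Gyrogroup G] : Prop
    extends ContinuousAdd G, ContinuousNeg G

/-- A property `Q` of topological spaces is a three-space property in topological gyrogroups if,
for every Hausdorff topological gyrogroup `G` and every closed L-subgyrogroup `H` of `G` such that
`H` (with the subspace topology) and `G/H` (with the quotient topology) have `Q`, also `G` has
`Q`. -/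
def IsThreeSpaceProperty (Q : (X : Type u) → [TopologicalSpace X] → Prop) : Prop :=
  ∀ (G : Type u) [TopologicalSpace G] [T2Space G] [Gyrogroup G] [IsTopologicalGyrogroup G]
    (H : Set G), Gyrogroup.IsLSubgyrogroup H → IsClosed H →
    Q H → Q (Gyrogroup.CosetSpace H) → Q G

/-- Every sequentially compact subset of `X` is a sequential space (in the subspace topology). -/
def EverySeqCompactSubsetSequential (X : Type u) [TopologicalSpace X] : Prop :=
  ∀ S : Set X, IsSeqCompact S → SequentialSpace S

open Filter

section Sequential

/-! Let `A` be sequentially closed in `S`, so that its image `B` in `G` is sequentially compact, and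
suppose that `x ∈ S` lies in the closure of `B` but not in `B`. The hypothesis on `H`, translated to
the fibre `x ⊕ H`, gives a neighbourhood `U` of `x` with `B ∩ U` disjoint from `x ⊕ H`. By
regularity `U` contains a closed neighbourhood `C` of `x`. The image of `B ∩ C` in `G/H` is
sequentially compact, hence closed in the sequential image of `S`, so it contains the coset of `x`.
Thus `B ∩ C` meets `x ⊕ H`, a contradiction. -/

theorem IsSeqCompact.isSeqClosed_of_t2 {X : Type*} [TopologicalSpace X] [T2Space X] {B : Set X}
    (hB : IsSeqCompact B) : IsSeqClosed B := by
  intro u p hu hp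
  obtain ⟨b, hb, φ, hφ, hlim⟩ := hB hu
  rwa [tendsto_nhds_unique (hp.comp hφ.tendsto_atTop) hlim]

theorem IsSeqCompact.inter_isClosed {X : Type*} [TopologicalSpace X] {B C : Set X}
    (hB : IsSeqCompact B) (hC : IsClosed C) : IsSeqCompact (B ∩ C) := by
  intro u hu
  obtain ⟨b, hb, φ, hφ, hlim⟩ := hB fun n => (hu n).1
  exact ⟨b, ⟨hb, hC.mem_of_tendsto hlim (Eventually.of_forall fun n => (hu (φ n)).2)⟩, φ, hφ, hlim⟩

theorem IsSeqCompact.image_val_of_isSeqClosed {X : Type*} [TopologicalSpace X] {S : Set X}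
    (hS : IsSeqCompact S) {A : Set S} (hA : IsSeqClosed A) :
    IsSeqCompact (Subtype.val '' A) := by
  intro u hu
  choose v hvA hvu using hu
  obtain ⟨s, hs, φ, hφ, hlim⟩ := hS fun n => hvu n ▸ (v n).2
  refine ⟨s, ⟨⟨s, hs⟩, hA (x := v ∘ φ) (fun n => hvA (φ n)) ?_, rfl⟩, φ, hφ, hlim⟩
  rw [tendsto_subtype_rng]
  exact hlim.congr fun n => (hvu (φ n)).symm

/-- In a Hausdorff space, a sequentially compact subset of a sequential subspace is relatively
closed. -/
theorem IsSeqCompact.mem_of_mem_closure {X : Type*} [TopologicalSpace X] [T2Space X] {S B : Set X}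
    [SequentialSpace S] (hB : IsSeqCompact B) {x : X} (hx : x ∈ S) (hBS : B ⊆ S)
    (hxB : x ∈ closure B) : x ∈ B := by
  have hcl : IsClosed ((↑) ⁻¹' B : Set S) :=
    (hB.isSeqClosed_of_t2.preimage continuous_subtype_val.seqContinuous).isClosed
  obtain ⟨C, hC, hCB⟩ := isClosed_induced_iff.1 hcl
  have hBC : B ⊆ C := fun b hb => (Set.ext_iff.1 hCB ⟨b, hBS hb⟩).2 hb
  exact (Set.ext_iff.1 hCB ⟨x, hx⟩).1 (closure_minimal hBC hC hxB)

end Sequential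

namespace Gyrogroup

variable {G : Type u} [Gyrogroup G]

theorem add_left_cancel' {x a b : G} (h : x + a = x + b) : a = b := by
  have h' := congrArg (-x + ·) h
  simp only [gyr_assoc, neg_add_self, zero_add] at h'
  exact (gyr (-x) x).injective h'

theorem gyr_zero_left (x z : G) : gyr 0 x z = z := by
  have h := gyr_assoc 0 x z
  rw [zero_add, zero_add] at h
  exact (add_left_cancel' h).symm

theorem neg_add_cancel_left (x z : G) : -x + (x + z) = z := by
  -- The loop property turns `gyr (-x) x` into `gyr 0 x`, which is the identity.
  rw [gyr_assoc, ← gyr_loop, neg_add_self, zero_add, gyr_zero_left]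

theorem add_neg_cancel_left (x z : G) : x + (-x + z) = z := by
  rw [gyr_assoc, ← gyr_loop, add_neg_self, zero_add, gyr_zero_left]

theorem mem_leftCoset_iff {H : Set G} {x y : G} : y ∈ leftCoset H x ↔ -x + y ∈ H := by
  constructor
  · rintro ⟨h, hh, rfl⟩
    simpa only [neg_add_cancel_left] using hh
  · exact fun h => ⟨_, h, add_neg_cancel_left x y⟩

theorem IsSubgyrogroup.zero_mem {H : Set G} (hH : IsSubgyrogroup H) : (0 : G) ∈ H := by
  obtain ⟨h, hh⟩ := hH.nonempty
  simpa only [neg_add_self] using hH.add_mem _ (hH.neg_mem h hh) h hh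

theorem IsSubgyrogroup.mem_leftCoset_self {H : Set G} (hH : IsSubgyrogroup H) (x : G) :
    x ∈ leftCoset H x :=
  ⟨0, hH.zero_mem, add_zero x⟩

theorem IsLSubgyrogroup.leftCoset_add {H : Set G} (hH : IsLSubgyrogroup H) (x : G) {h : G}
    (hh : h ∈ H) : leftCoset H (x + h) = leftCoset H x := by
  apply Subset.antisymm
  · rintro _ ⟨k, hk, rfl⟩
    rw [← hH.gyr_image_left x h hh] at hk
    obtain ⟨l, hl, rfl⟩ := hk
    exact ⟨h + l, hH.add_mem h hh l hl, gyr_assoc x h l⟩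
  · rintro _ ⟨k, hk, rfl⟩
    refine ⟨gyr x h (-h + k), ?_, ?_⟩
    · rw [← hH.gyr_image_left x h hh]
      exact mem_image_of_mem _ (hH.add_mem _ (hH.neg_mem h hh) k hk)
    · change (x + h) + gyr x h (-h + k) = x + k
      rw [← gyr_assoc, add_neg_cancel_left]

theorem IsLSubgyrogroup.mk_eq_mk_iff {H : Set G} (hH : IsLSubgyrogroup H) {x y : G} :
    CosetSpace.mk H x = CosetSpace.mk H y ↔ -x + y ∈ H := by
  rw [← mem_leftCoset_iff]
  constructor
  · intro h
    rw [show leftCoset H x = leftCoset H y from congrArg Subtype.val h]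
    exact hH.mem_leftCoset_self y
  · rintro ⟨h, hh, rfl⟩
    exact Subtype.ext (hH.leftCoset_add x hh).symm

variable [TopologicalSpace G] [IsTopologicalGyrogroup G]

/-- If `W ⊕ V ⊆ U`, then `closure W ⊆ U`: a point `y` of the closure has some `w ∈ W` with `-w + y ∈
V`, and `y = w + (-w + y)`. -/
theorem regularSpace : RegularSpace G := by
  refine .of_exists_mem_nhds_isClosed_subset fun x U hU => ?_
  have hadd : Tendsto (fun p : G × G => p.1 + p.2) (𝓝 x ×ˢ 𝓝 0) (𝓝 x) := by
    simpa only [nhds_prod_eq, add_zero] using (continuous_add (M := G)).tendsto (x, 0)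
  obtain ⟨W, hW, V, hV, hWV⟩ := mem_prod_iff.1 (hadd hU)
  refine ⟨closure W, mem_of_superset hW subset_closure, isClosed_closure, fun y hy => ?_⟩
  have hcont : Continuous fun w : G => -w + y := by fun_prop
  have hy' : (fun w : G => -w + y) ⁻¹' V ∈ 𝓝 y :=
    hcont.continuousAt (by simpa only [neg_add_self] using hV)
  obtain ⟨w, hwV, hwW⟩ := mem_closure_iff_nhds.1 hy _ hy'
  have := @hWV (w, -w + y) ⟨hwW, hwV⟩
  simpa only [mem_preimage, add_neg_cancel_left] using this

theorem IsLSubgyrogroup.isOpenQuotientMap_mk {H : Set G} (hH : IsLSubgyrogroup H) :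
    IsOpenQuotientMap (CosetSpace.mk H) where
  surjective := fun ⟨_, a, ha⟩ => ⟨a, Subtype.ext ha⟩
  continuous := continuous_coinduced_rng
  isOpenMap U hU := by
    -- Written with preimages, the saturation of `U` is open by mere continuity of right
    -- translations.
    have hpre : CosetSpace.mk H ⁻¹' (CosetSpace.mk H '' U) = ⋃ k ∈ H, (fun y => y + k) ⁻¹' U := by
      ext y
      simp only [mem_preimage, mem_image, mem_iUnion, exists_prop]
      constructor
      · rintro ⟨u, hu, huy⟩
        exact ⟨-y + u, hH.mk_eq_mk_iff.1 huy.symm, by rwa [add_neg_cancel_left]⟩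
      · rintro ⟨k, hk, hyk⟩
        exact ⟨y + k, hyk, Subtype.ext (hH.leftCoset_add y hk)⟩
    refine isOpen_coinduced.2 ?_
    rw [hpre]
    exact isOpen_biUnion fun k _ => hU.preimage (by fun_prop)

theorem IsLSubgyrogroup.t2Space_cosetSpace {H : Set G} (hH : IsLSubgyrogroup H)
    (hcl : IsClosed H) : T2Space (CosetSpace H) := by
  rw [t2Space_iff_of_isOpenQuotientMap hH.isOpenQuotientMap_mk]
  have hcont : Continuous fun p : G × G => -p.1 + p.2 := by fun_prop
  convert hcl.preimage hcont using 1
  ext p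
  exact hH.mk_eq_mk_iff

theorem isSeqCompact_preimage_translate {H : Set G} (hcl : IsClosed H) {B : Set G}
    (hB : IsSeqCompact B) (x : G) : IsSeqCompact {h : H | x + (h : G) ∈ B} := by
  intro u hu
  obtain ⟨b, hb, φ, hφ, hlim⟩ := hB hu
  have hcont : Continuous fun y : G => -x + y := by fun_prop
  have hlim' : Tendsto (fun n => (u (φ n) : G)) atTop (𝓝 (-x + b)) := by
    refine ((hcont.tendsto b).comp hlim).congr fun n => ?_
    exact neg_add_cancel_left x _
  have hmem : -x + b ∈ H := hcl.mem_of_tendsto hlim' (Eventually.of_forall fun n => (u (φ n)).2)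
  refine ⟨⟨-x + b, hmem⟩, ?_, φ, hφ, tendsto_subtype_rng.2 hlim'⟩
  simpa only [mem_ofPred_eq, add_neg_cancel_left] using hb

/-- The base half: relative closedness of the image of `B` in that of `S`. -/
theorem IsLSubgyrogroup.exists_mem_leftCoset_of_mem_closure {H : Set G} (hH : IsLSubgyrogroup H)
    (hcl : IsClosed H) (hQ : EverySeqCompactSubsetSequential (CosetSpace H)) {S B : Set G}
    (hS : IsSeqCompact S) (hB : IsSeqCompact B) (hBS : B ⊆ S) {x : G} (hx : x ∈ S)
    (hxB : x ∈ closure B) : ∃ b ∈ B, -x + b ∈ H := by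
  have := hH.t2Space_cosetSpace hcl
  have hπ : Continuous (CosetSpace.mk H) := hH.isOpenQuotientMap_mk.continuous
  have := hQ _ (hS.image hπ.seqContinuous)
  obtain ⟨b, hb, hbx⟩ := (hB.image hπ.seqContinuous).mem_of_mem_closure (mem_image_of_mem _ hx)
    (image_mono hBS) (image_closure_subset_closure_image hπ (mem_image_of_mem _ hxB))
  exact ⟨b, hb, hH.mk_eq_mk_iff.1 hbx.symm⟩

/-- The fibre half: left translation by `-x` moves `x` to `0` and `B ∩ (x ⊕ H)` to a relatively
closed part of a sequential subset of `H`. -/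
theorem IsSubgyrogroup.exists_nhds_disjoint_leftCoset [T2Space G] {H : Set G}
    (hH : IsSubgyrogroup H) (hcl : IsClosed H) (hQ : EverySeqCompactSubsetSequential H)
    {S B : Set G} (hS : IsSeqCompact S) (hB : IsSeqCompact B) (hBS : B ⊆ S) {x : G} (hx : x ∈ S)
    (hxB : x ∉ B) : ∃ U ∈ 𝓝 x, ∀ b ∈ B, b ∈ U → -x + b ∉ H := by
  have := hQ _ (isSeqCompact_preimage_translate hcl hS x)
  have h0 : (⟨0, hH.zero_mem⟩ : H) ∉ closure {h : H | x + (h : G) ∈ B} := fun h =>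
    hxB <| by
      simpa only [mem_ofPred_eq, add_zero] using
        (isSeqCompact_preimage_translate hcl hB x).mem_of_mem_closure
          (S := {h : H | x + (h : G) ∈ S})
          (by simpa only [mem_ofPred_eq, add_zero] using hx) (fun h hh => hBS hh) h
  obtain ⟨O, hO, hOD⟩ := isOpen_induced_iff.1 (isClosed_closure.isOpen_compl (X := H)
    (s := closure {h : H | x + (h : G) ∈ B}))
  have hcont : Continuous fun y : G => -x + y := by fun_prop
  refine ⟨(fun y => -x + y) ⁻¹' O, (hO.preimage hcont).mem_nhds ?_, fun b hb hbO hbH => ?_⟩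
  · simpa only [mem_preimage, neg_add_self] using (Set.ext_iff.1 hOD ⟨0, hH.zero_mem⟩).2 h0
  · refine (Set.ext_iff.1 hOD ⟨-x + b, hbH⟩).1 hbO (subset_closure ?_)
    simpa only [mem_ofPred_eq, add_neg_cancel_left] using hb

end Gyrogroup

theorem theorem4p9 : IsThreeSpaceProperty.{u} EverySeqCompactSubsetSequential.{u} := by
  intro G _ _ _ _ H hH hcl hQH hQ S hS
  refine ⟨fun A hA => isClosed_of_closure_subset fun x hxA => ?_⟩
  have hB := hS.image_val_of_isSeqClosed hA
  have hBS : Subtype.val '' A ⊆ S := Subtype.coe_image_subset S A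
  have hxB : (x : G) ∈ closure (Subtype.val '' A) := closure_subtype.1 hxA
  by_contra hx
  have hxB' : (x : G) ∉ Subtype.val '' A := fun ⟨y, hy, hyx⟩ => hx (Subtype.ext hyx ▸ hy)
  obtain ⟨U, hU, hdisj⟩ :=
    hH.exists_nhds_disjoint_leftCoset hcl hQH hS hB hBS x.2 hxB'
  have := Gyrogroup.regularSpace (G := G)
  -- `C` must be closed for `B ∩ C` to stay sequentially compact.
  obtain ⟨C, hC, hCcl, hCU⟩ := exists_mem_nhds_isClosed_subset hU
  have hxBC : (x : G) ∈ closure (Subtype.val '' A ∩ C) := by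
    rw [mem_closure_iff_nhds] at hxB ⊢
    intro t ht
    obtain ⟨y, ⟨hyt, hyC⟩, hyA⟩ := hxB _ (inter_mem ht hC)
    exact ⟨y, hyt, hyA, hyC⟩
  obtain ⟨b, ⟨hbA, hbC⟩, hbH⟩ := hH.exists_mem_leftCoset_of_mem_closure hcl hQ hS
    (hB.inter_isClosed hCcl) (inter_subset_left.trans hBS) x.2 hxBC
  exact hdisj b hbA (hCU hbC) hbH
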